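/- Let $V$ be a complex vertex operator algebra with vacuum $\mathbf 1$, Virasoro element $\omega$, vertex operators $Y(a,x)=\sum_{n\in\mathbb Z}a(n)x^{-n-1}$ and Virasoro operators $L_n=\omega(n+1)$, graded by the nonnegative integral eigenvalues of $L_0$: $V=\bigoplus_{n=0}^{\infty}V(n)$ with $V(n)=\{a\in V: L_0a=na\}$. Assume that $V(0)=\mathbb C\mathbf 1$ and that $V$ is $C_2$-finite, i.e. $\dim V/C_2(V)<\infty$, where $C_2(V)$ is the linear span of all $a(-2)b$ with $a,b\in V$. Let $U\subset V$ be a graded subspace, i.e. $U=\bigoplus_{n}(U\cap V(n))$, such that $V=U\oplus C_2(V)$ (so $U$ is finite dimensional). Let $W$ be a weak $V$-module: a complex vector space with a linear map $a\mapsto Y_W(a,x)=\sum_{n\in\mathbb Z}a(n)x^{-n-1}$ from $V$ to $(\mathrm{End}\,W)[[x,x^{-1}]]$ such that $Y_W(a,x)w\in W((x))$, $Y_W(\mathbf 1,x)=\mathrm{id}_W$, and, for all $a,b\in V$, $w\in W$ and $p,q,r\in\mathbb Z$, $$\sum_{i\ge 0}\binom{p}{i}(a(r+i)b)(p+q-i)w=\sum_{i\ge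 0}(-1)^i\binom{r}{i}\bigl(a(p+r-i)b(q+i)w-(-1)^r b(q+r-i)a(p+i)w\bigr).$$ Assume that $W$ is $B_1$-finite, i.e. $\dim W/B_1(W)<\infty$, where $B_1(W)$ is the linear span of all $a(-1)w$ with $w\in W$ and $a\in V(k)$ for some $k>0$. Then for every integer $m>0$ the quotient $W/C_m(U,W)$ is finite dimensional, where $C_m(U,W)$ is the linear span of all $a(-n)w$ with $a\in U$, $w\in W$ and $n\ge m$. -/

import Mathlib

universe u v

/-- The mode `a(n) ∈ End W` of `Y(a, x) = ∑ a(n) x^(-n-1)`, for a linear map `Y` sending `a ∈ V` to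
a field on `W` (a linear map from `W` to the Laurent series `W((x))`). -/
def fieldMode {V : Type u} {W : Type v} [AddCommGroup V] [Module ℂ V] [AddCommGroup W] [Module ℂ W]
    (Y : V →ₗ[ℂ] VertexOperator ℂ W) (a : V) (n : ℤ) : Module.End ℂ W :=
  VertexOperator.ncoeff (Y a) n

/-- Truncation: `a(n) w = 0` for all large `n`. -/
theorem exists_fieldMode_eq_zero {V : Type u} {W : Type v} [AddCommGroup V] [Module ℂ V]
    [AddCommGroup W] [Module ℂ W] (Y : V →ₗ[ℂ] VertexOperator ℂ W) (a : V) (w : W) :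
    ∃ N : ℤ, ∀ n : ℤ, N ≤ n → fieldMode Y a n w = 0 := by
  refine ⟨-((HahnModule.of ℂ).symm ((Y a) w)).order, fun n hn => ?_⟩
  exact VertexOperator.ncoeff_eq_zero_of_lt_order _ _ _ (by omega)

/-- The Borcherds (Jacobi) identity for modes. Here `YV` is the state-field map of `V` and `Y` that
of `W`. Both sums have only finitely many nonzero terms, see `borcherds_left_finite` and
`borcherds_right_finite`. -/
def BorcherdsIdentity {V : Type u} {W : Type v} [AddCommGroup V] [Module ℂ V]
    [AddCommGroup W] [Module ℂ W]
    (YV : V →ₗ[ℂ] VertexOperator ℂ V) (Y : V →ₗ[ℂ] VertexOperator ℂ W) : Prop :=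
  ∀ (a b : V) (w : W) (p q r : ℤ),
    ∑ᶠ i : ℕ, Ring.choose p i • fieldMode Y (fieldMode YV a (r + i) b) (p + q - i) w =
    ∑ᶠ i : ℕ, ((-1 : ℤ) ^ i * Ring.choose r i) •
      (fieldMode Y a (p + r - i) (fieldMode Y b (q + i) w) -
        (-1 : ℂ) ^ r • fieldMode Y b (q + r - i) (fieldMode Y a (p + i) w))

theorem borcherds_left_finite {V : Type u} {W : Type v} [AddCommGroup V] [Module ℂ V]
    [AddCommGroup W] [Module ℂ W]
    (YV : V →ₗ[ℂ] VertexOperator ℂ V) (Y : V →ₗ[ℂ] VertexOperator ℂ W)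
    (a b : V) (w : W) (p q r : ℤ) :
    (Function.support fun i : ℕ =>
      Ring.choose p i • fieldMode Y (fieldMode YV a (r + i) b) (p + q - i) w).Finite := by
  obtain ⟨N, hN⟩ := exists_fieldMode_eq_zero YV a b
  refine (Set.finite_lt_nat (N - r).toNat).subset fun i hi => ?_
  by_contra h
  simp only [Set.mem_ofPred_eq, not_lt] at h
  apply hi
  have h0 : fieldMode YV a (r + i) b = 0 := hN _ (by omega)
  have h1 : fieldMode Y (0 : V) (p + q - i) = 0 := by simp [fieldMode]
  simp [h0, h1]

theorem borcherds_right_finite {V : Type u} {W : Type v} [AddCommGroup V] [Module ℂ V]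
    [AddCommGroup W] [Module ℂ W] (Y : V →ₗ[ℂ] VertexOperator ℂ W)
    (a b : V) (w : W) (p q r : ℤ) :
    (Function.support fun i : ℕ => ((-1 : ℤ) ^ i * Ring.choose r i) •
      (fieldMode Y a (p + r - i) (fieldMode Y b (q + i) w) -
        (-1 : ℂ) ^ r • fieldMode Y b (q + r - i) (fieldMode Y a (p + i) w))).Finite := by
  obtain ⟨N, hN⟩ := exists_fieldMode_eq_zero Y a w
  obtain ⟨M, hM⟩ := exists_fieldMode_eq_zero Y b w
  refine (Set.finite_lt_nat ((N - p).toNat + (M - q).toNat)).subset fun i hi => ?_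
  by_contra h
  simp only [Set.mem_ofPred_eq, not_lt] at h
  apply hi
  have h1 : fieldMode Y a (p + i) w = 0 := hN _ (by omega)
  have h2 : fieldMode Y b (q + i) w = 0 := hM _ (by omega)
  simp [h1, h2]

/-- A vertex operator algebra structure on the complex vector space `V`, graded by `ℕ` through the
eigenvalues of `L₀`. -/
structure VertexOperatorAlgebra (V : Type u) [AddCommGroup V] [Module ℂ V] where
  /-- The state-field map `a ↦ Y(a, x)`. -/
  Y : V →ₗ[ℂ] VertexOperator ℂ V
  /-- The vacuum element. -/
  vacuum : V
  /-- The Virasoro element `ω`; the Virasoro operators are `Lₙ = ω(n+1)`. -/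
  conformal : V
  /-- The central charge. -/
  centralCharge : ℂ
  vacuum_mode : ∀ n : ℤ, fieldMode Y vacuum n = if n = -1 then 1 else 0
  mode_neg_one_vacuum : ∀ a : V, fieldMode Y a (-1) vacuum = a
  mode_vacuum_of_nonneg : ∀ (a : V) (n : ℤ), 0 ≤ n → fieldMode Y a n vacuum = 0
  borcherds : BorcherdsIdentity Y Y
  virasoro : ∀ m n : ℤ,
    fieldMode Y conformal (m + 1) * fieldMode Y conformal (n + 1) -
      fieldMode Y conformal (n + 1) * fieldMode Y conformal (m + 1) =
    ((m : ℂ) - n) • fieldMode Y conformal (m + n + 1) +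
      (if m + n = 0 then ((m : ℂ) ^ 3 - m) / 12 * centralCharge else 0) • (1 : Module.End ℂ V)
  /-- `(L₋₁ a)(n) = -n a(n-1)`. -/
  mode_translation : ∀ (a : V) (n : ℤ),
    fieldMode Y (fieldMode Y conformal 0 a) n = (-(n : ℂ)) • fieldMode Y a (n - 1)
  grading : DirectSum.IsInternal fun n : ℕ =>
    Module.End.eigenspace (fieldMode Y conformal 1) (n : ℂ)

/-- The space `V(n)` of homogeneous vectors of weight `n`, i.e. the `n`-eigenspace of `L₀`. -/
def VertexOperatorAlgebra.weightSpace {V : Type u} [AddCommGroup V] [Module ℂ V]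
    (A : VertexOperatorAlgebra V) (n : ℕ) : Submodule ℂ V :=
  Module.End.eigenspace (fieldMode A.Y A.conformal 1) (n : ℂ)

/-- `U` is a graded subspace: `U = ⊕ₙ (U ∩ V(n))`. -/
def VertexOperatorAlgebra.IsGradedSubspace {V : Type u} [AddCommGroup V] [Module ℂ V]
    (A : VertexOperatorAlgebra V) (U : Submodule ℂ V) : Prop :=
  U = ⨆ n : ℕ, U ⊓ A.weightSpace n

/-- A weak module structure on `W`. No grading and no action of `L₀` is prescribed. -/
structure WeakVOAModule {V : Type u} [AddCommGroup V] [Module ℂ V] (A : VertexOperatorAlgebra V)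
    (W : Type v) [AddCommGroup W] [Module ℂ W] where
  /-- The map `a ↦ Y_W(a, x)`. -/
  Y : V →ₗ[ℂ] VertexOperator ℂ W
  vacuum_mode : ∀ n : ℤ, fieldMode Y A.vacuum n = if n = -1 then 1 else 0
  borcherds : BorcherdsIdentity A.Y Y

/-- `V` as a module over itself. -/
def VertexOperatorAlgebra.adjointModule {V : Type u} [AddCommGroup V] [Module ℂ V]
    (A : VertexOperatorAlgebra V) : WeakVOAModule A V where
  Y := A.Y
  vacuum_mode := A.vacuum_mode
  borcherds := A.borcherds

namespace WeakVOAModule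

/-- `Cₙ(W)`, the span of all `a(-n) w` with `a ∈ V` and `w ∈ W`. -/
def spaceC {V : Type u} [AddCommGroup V] [Module ℂ V] {A : VertexOperatorAlgebra V}
    {W : Type v} [AddCommGroup W] [Module ℂ W] (M : WeakVOAModule A W) (n : ℕ) : Submodule ℂ W :=
  Submodule.span ℂ {x | ∃ (a : V) (w : W), x = fieldMode M.Y a (-(n : ℤ)) w}

/-- `B₁(W)`, the span of all `a(-1) w` with `a` homogeneous of positive weight and `w ∈ W`. -/
def spaceB {V : Type u} [AddCommGroup V] [Module ℂ V] {A : VertexOperatorAlgebra V}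
    {W : Type v} [AddCommGroup W] [Module ℂ W] (M : WeakVOAModule A W) : Submodule ℂ W :=
  Submodule.span ℂ {x | ∃ k : ℕ, 0 < k ∧ ∃ a ∈ A.weightSpace k, ∃ w : W,
    x = fieldMode M.Y a (-1) w}

/-- `C_m(U, W)`, the span of all `a(-n) w` with `a ∈ U`, `w ∈ W` and `n ≥ m`. -/
def spaceCRel {V : Type u} [AddCommGroup V] [Module ℂ V] {A : VertexOperatorAlgebra V}
    {W : Type v} [AddCommGroup W] [Module ℂ W] (M : WeakVOAModule A W)
    (U : Submodule ℂ V) (m : ℕ) : Submodule ℂ W :=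
  Submodule.span ℂ {x | ∃ a ∈ U, ∃ w : W, ∃ n : ℕ, m ≤ n ∧ x = fieldMode M.Y a (-(n : ℤ)) w}

/-- `W` is `B₁`-finite: `W / B₁(W)` is finite dimensional. -/
def IsBFinite {V : Type u} [AddCommGroup V] [Module ℂ V] {A : VertexOperatorAlgebra V}
    {W : Type v} [AddCommGroup W] [Module ℂ W] (M : WeakVOAModule A W) : Prop :=
  FiniteDimensional ℂ (W ⧸ M.spaceB)

/-- `W` is `Cₙ`-finite: `W / Cₙ(W)` is finite dimensional. -/
def IsCFinite {V : Type u} [AddCommGroup V] [Module ℂ V] {A : VertexOperatorAlgebra V}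
    {W : Type v} [AddCommGroup W] [Module ℂ W] (M : WeakVOAModule A W) (n : ℕ) : Prop :=
  FiniteDimensional ℂ (W ⧸ M.spaceC n)

end WeakVOAModule

/-!
Write `a_[m] = a(-m-1)` and consider words in operators `a_[m]` on `W`, with `a` homogeneous of
weight `wt a > 0`. A word has a weight, the sum of the `wt a`, and a degree, the sum of the
`wt a + m`. Each instance of the Borcherds identity is homogeneous for the degree and filtered for
the weight. Modulo words of lower weight and the same degree, the following holds.

* Letters commute (`wordAction_sub_mem_of_perm`), as `a(i)b` with `i ≥ 0` has weight less than
  `wt a + wt b`. A word with a letter in `C₂(V)` vanishes (`fieldCoeff_mem_of_mem_homogeneousC2`),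
  as `a(-2)b` has weight greater than `wt a + wt b`.
* The word `a¹_[p] ⋯ aᵗ_[p]` is `(a¹(-1)⋯aᵗ(-1)𝟏)_[tp]` plus words in the same letters whose
  indices are not all equal, but have the same sum, and hence have a larger sum of squares
  (`fieldCoeff_normalProduct_sub_mem`). Since `V / C₂(V)` is finite dimensional, `C₂(V)` contains all
  vectors of weight greater than some `h`, in particular the product of any `t > h` letters. So a
  word that repeats an index more than `h` times can be rewritten with indices more spread out.

If all weights are at most `h`, all indices are less than `m`, and no index is repeated more than
`h` times, then the degree is bounded, whatever the length. A word of larger degree can therefore be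
spread out until an index is at least `m`, and then `V = U + C₂(V)` puts it into `C_m(U, W)`. The
process stops because words of given weight and degree have bounded length and index sum, so that
indices which are also bounded above have a bounded sum of squares. Thus every word of large degree
maps all of `W` into `C_m(U, W)` (`wordAction_mem_spaceCRel`).

Finally, `B₁(W)` is contained in the span of the `u_[i]w` with `u ∈ U` of positive weight and `i ≥ 0`
(`spaceB_le_positiveModeSpan`). With a finite dimensional complement `X` of `B₁(W)`, repeated
substitution writes `W` as the sum of finitely many finite dimensional spaces of words applied to
`X` and of words of large degree applied to `W`; the latter lie in `C_m(U, W)`.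
-/

/-! ### Modes and the Borcherds identity -/

section Modes

variable {V : Type u} {W : Type v} [AddCommGroup V] [Module ℂ V] [AddCommGroup W] [Module ℂ W]

/-- The coefficient `a_[m] = a(-m-1)` of `x ^ m` in the field `Y(a, x)`. In this indexing the index
of a normally ordered product is the sum of the indices of its factors. -/
def fieldCoeff (Y : V →ₗ[ℂ] VertexOperator ℂ W) (a : V) (m : ℤ) : Module.End ℂ W :=
  fieldMode Y a (-m - 1)

theorem fieldMode_add (Y : V →ₗ[ℂ] VertexOperator ℂ W) (a b : V) (n : ℤ) :
    fieldMode Y (a + b) n = fieldMode Y a n + fieldMode Y b n := by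
  simp [fieldMode]

theorem fieldMode_smul (Y : V →ₗ[ℂ] VertexOperator ℂ W) (c : ℂ) (a : V) (n : ℤ) :
    fieldMode Y (c • a) n = c • fieldMode Y a n := by
  simp [fieldMode]

theorem fieldMode_zero (Y : V →ₗ[ℂ] VertexOperator ℂ W) (n : ℤ) :
    fieldMode Y (0 : V) n = 0 := by
  simp [fieldMode]

/-- The mode `a(n)` as a bilinear map in `a` and the vector it acts on. -/
def fieldModeLinear (Y : V →ₗ[ℂ] VertexOperator ℂ W) (n : ℤ) : V →ₗ[ℂ] Module.End ℂ W where
  toFun a := fieldMode Y a n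
  map_add' a b := fieldMode_add Y a b n
  map_smul' c a := fieldMode_smul Y c a n

theorem fieldCoeff_add (Y : V →ₗ[ℂ] VertexOperator ℂ W) (a b : V) (m : ℤ) :
    fieldCoeff Y (a + b) m = fieldCoeff Y a m + fieldCoeff Y b m :=
  fieldMode_add Y a b _

theorem fieldCoeff_smul (Y : V →ₗ[ℂ] VertexOperator ℂ W) (c : ℂ) (a : V) (m : ℤ) :
    fieldCoeff Y (c • a) m = c • fieldCoeff Y a m :=
  fieldMode_smul Y c a _

theorem fieldCoeff_zero (Y : V →ₗ[ℂ] VertexOperator ℂ W) (m : ℤ) :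
    fieldCoeff Y (0 : V) m = 0 :=
  fieldMode_zero Y _

/-- Borcherds' commutator formula, the case `r = 0` of the Borcherds identity. -/
theorem BorcherdsIdentity.commutator {YV : V →ₗ[ℂ] VertexOperator ℂ V}
    {Y : V →ₗ[ℂ] VertexOperator ℂ W} (h : BorcherdsIdentity YV Y) (a b : V) (w : W) (p q : ℤ) :
    fieldMode Y a p (fieldMode Y b q w) - fieldMode Y b q (fieldMode Y a p w) =
      ∑ᶠ i : ℕ, Ring.choose p i • fieldMode Y (fieldMode YV a i b) (p + q - i) w := by
  have := h a b w p q 0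
  rw [finsum_eq_single (fun i : ℕ => ((-1 : ℤ) ^ i * Ring.choose (0 : ℤ) i) • _) 0] at this
  · simpa using this.symm
  · intro i hi
    simp [Ring.choose_zero_pos ℤ (Nat.pos_of_ne_zero hi)]

/-- The associativity formula, the case `p = 0` of the Borcherds identity. -/
theorem BorcherdsIdentity.associativity {YV : V →ₗ[ℂ] VertexOperator ℂ V}
    {Y : V →ₗ[ℂ] VertexOperator ℂ W} (h : BorcherdsIdentity YV Y) (a b : V) (w : W) (q r : ℤ) :
    fieldMode Y (fieldMode YV a r b) q w =
      ∑ᶠ i : ℕ, ((-1 : ℤ) ^ i * Ring.choose r i) •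
      (fieldMode Y a (r - i) (fieldMode Y b (q + i) w) -
        (-1 : ℂ) ^ r • fieldMode Y b (q + r - i) (fieldMode Y a i w)) := by
  have := h a b w 0 q r
  rw [finsum_eq_single (fun i : ℕ => Ring.choose (0 : ℤ) i • _) 0] at this
  · simpa using this
  · intro i hi
    simp [Ring.choose_zero_pos ℤ (Nat.pos_of_ne_zero hi)]

/-- Associativity for the normally ordered product `a(-1)b`. -/
theorem BorcherdsIdentity.fieldCoeff_normalProduct {YV : V →ₗ[ℂ] VertexOperator ℂ V}
    {Y : V →ₗ[ℂ] VertexOperator ℂ W} (h : BorcherdsIdentity YV Y) (a b : V) (w : W) (m : ℤ) :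
    fieldCoeff Y (fieldMode YV a (-1) b) m w =
      ∑ᶠ i : ℕ, (fieldCoeff Y a i (fieldCoeff Y b (m - i) w) +
        fieldCoeff Y b (m + 1 + i) (fieldCoeff Y a (-1 - i) w)) := by
  rw [fieldCoeff, h.associativity]
  refine finsum_congr fun i => ?_
  have hc : (-1 : ℤ) ^ i * Ring.choose (-1 : ℤ) i = 1 := by
    rw [Ring.choose_neg', Ring.multichoose_one, Units.smul_def]
    rcases Nat.even_or_odd i with h | h
    · simp [h.neg_one_pow, Int.negOnePow_even _ (Int.even_coe_nat i |>.2 h)]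
    · simp [h.neg_one_pow, Int.negOnePow_odd _ (Int.odd_coe_nat i |>.2 h)]
  rw [hc, one_smul, zpow_neg_one]
  simp only [fieldCoeff]
  rw [show (-1 - (i : ℤ)) = -i - 1 by ring, show (-m - 1 + (i : ℤ)) = -(m - i) - 1 by ring,
    show (-m - 1 + -1 - (i : ℤ)) = -(m + 1 + i) - 1 by ring, show -(-(i : ℤ) - 1) - 1 = i by ring]
  norm_num

theorem finite_support_normalProduct
    (Y : V →ₗ[ℂ] VertexOperator ℂ W) (a b : V) (w : W) (m : ℤ) :
    (Function.support fun i : ℕ => (fieldCoeff Y a i (fieldCoeff Y b (m - i) w) +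
        fieldCoeff Y b (m + 1 + i) (fieldCoeff Y a (-1 - i) w))).Finite := by
  obtain ⟨N, hN⟩ := exists_fieldMode_eq_zero Y a w
  obtain ⟨K, hK⟩ := exists_fieldMode_eq_zero Y b w
  refine (Set.finite_lt_nat (N.toNat + (K + m + 1).toNat)).subset fun i hi => ?_
  by_contra hlt
  simp only [Set.mem_ofPred_eq, not_lt] at hlt
  apply hi
  have h1 : fieldCoeff Y a (-1 - i) w = 0 := hN _ (by omega)
  have h2 : fieldCoeff Y b (m - i) w = 0 := hK _ (by omega)
  simp [h1, h2]

end Modes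

/-! ### Weights, and the grading of `C₂(V)` -/

namespace VertexOperatorAlgebra

variable {V : Type u} [AddCommGroup V] [Module ℂ V] (A : VertexOperatorAlgebra V)

theorem mem_weightSpace_iff {n : ℕ} {a : V} :
    a ∈ A.weightSpace n ↔ fieldMode A.Y A.conformal 1 a = (n : ℂ) • a :=
  Module.End.mem_eigenspace_iff

theorem iSup_weightSpace : ⨆ n, A.weightSpace n = ⊤ :=
  A.grading.submodule_iSup_eq_top

theorem iSupIndep_weightSpace : iSupIndep A.weightSpace :=
  A.grading.submodule_iSupIndep

/-- `L₀` acts on `a(n)b` by the scalar `wt a + wt b - n - 1`. -/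
theorem conformal_one_mode {k l : ℕ} {a b : V} (ha : a ∈ A.weightSpace k)
    (hb : b ∈ A.weightSpace l) (n : ℤ) :
    fieldMode A.Y A.conformal 1 (fieldMode A.Y a n b) =
      ((k + l - n - 1 : ℤ) : ℂ) • fieldMode A.Y a n b := by
  rw [mem_weightSpace_iff] at ha hb
  have h := A.borcherds.commutator A.conformal a b 1 n
  rw [finsum_eq_sum_of_support_subset (s := Finset.range 2)] at h
  · simp only [Finset.sum_range_succ, Finset.sum_range_zero, zero_add, Nat.cast_zero, Nat.cast_one,
      Ring.choose_zero_right, Ring.choose_one_right, one_smul, A.mode_translation, ha,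
      fieldMode_smul, hb, map_smul, LinearMap.smul_apply, sub_zero] at h
    rw [sub_eq_iff_eq_add] at h
    rw [h, show (1 + n - 1 : ℤ) = n by ring, ← add_smul, ← add_smul]
    push_cast
    congr 1
    ring
  · intro i hi
    by_contra hlt
    apply hi
    have : Ring.choose (1 : ℤ) i = 0 := by
      have := Ring.choose_natCast (R := ℤ) 1 i
      simp only [Nat.cast_one] at this
      rw [this, Nat.choose_eq_zero_of_lt (by simpa using hlt)]
      rfl
    simp [this]

theorem eq_zero_of_conformal_one_eq {a : V} {n : ℤ} (hn : n < 0)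
    (ha : fieldMode A.Y A.conformal 1 a = (n : ℂ) • a) : a = 0 := by
  have hd := (Module.End.eigenspaces_iSupIndep (fieldMode A.Y A.conformal 1)) (n : ℂ)
  have htop : (⊤ : Submodule ℂ V) ≤ ⨆ (j : ℂ) (_ : j ≠ (n : ℂ)),
      Module.End.eigenspace (fieldMode A.Y A.conformal 1) j := by
    rw [← A.iSup_weightSpace]
    refine iSup_le fun k => ?_
    refine le_iSup₂_of_le (k : ℂ) ?_ le_rfl
    intro h
    have : ((k : ℤ) : ℂ) = (n : ℂ) := by simpa using h
    have := Int.cast_injective this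
    omega
  exact Submodule.disjoint_def.1 hd a (Module.End.mem_eigenspace_iff.2 ha) (htop trivial)

/-- The mode `a(n)` has degree `wt a - n - 1`. -/
theorem mode_mem_weightSpace {k l r : ℕ} {a b : V} (ha : a ∈ A.weightSpace k)
    (hb : b ∈ A.weightSpace l) {n : ℤ} (h : (r : ℤ) = k + l - n - 1) :
    fieldMode A.Y a n b ∈ A.weightSpace r := by
  rw [mem_weightSpace_iff, A.conformal_one_mode ha hb, ← h]
  simp

theorem mode_eq_zero_of_neg {k l : ℕ} {a b : V} (ha : a ∈ A.weightSpace k)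
    (hb : b ∈ A.weightSpace l) {n : ℤ} (h : (k + l - n - 1 : ℤ) < 0) :
    fieldMode A.Y a n b = 0 :=
  A.eq_zero_of_conformal_one_eq h (A.conformal_one_mode ha hb n)

theorem vacuum_mem_weightSpace : A.vacuum ∈ A.weightSpace 0 := by
  rw [mem_weightSpace_iff, A.mode_vacuum_of_nonneg _ _ zero_le_one]
  simp

/-- The homogeneous part of weight `k` of `C₂(V)`: the span of the `a(-2)b` with `a`, `b`
homogeneous and `wt a + wt b + 1 = k`. -/
def homogeneousC2 (k : ℕ) : Submodule ℂ V :=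
  Submodule.span ℂ {x | ∃ i j : ℕ, i + j + 1 = k ∧ ∃ a ∈ A.weightSpace i, ∃ b ∈ A.weightSpace j,
    x = fieldMode A.Y a (-2) b}

theorem homogeneousC2_le_weightSpace (k : ℕ) : A.homogeneousC2 k ≤ A.weightSpace k := by
  refine Submodule.span_le.2 ?_
  rintro _ ⟨i, j, rfl, a, ha, b, hb, rfl⟩
  exact A.mode_mem_weightSpace ha hb (by push_cast; ring)

theorem spaceC_two_le : A.adjointModule.spaceC 2 ≤ ⨆ k, A.homogeneousC2 k := by
  refine Submodule.span_le.2 ?_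
  rintro _ ⟨a, b, rfl⟩
  change fieldMode A.Y a (-2) b ∈ _
  have ha : a ∈ ⨆ n, A.weightSpace n := by rw [A.iSup_weightSpace]; trivial
  have hb : b ∈ ⨆ n, A.weightSpace n := by rw [A.iSup_weightSpace]; trivial
  induction ha using Submodule.iSup_induction' with
  | zero => simp [fieldMode_zero]
  | add x y _ _ hx hy => rw [fieldMode_add]; exact add_mem hx hy
  | mem i a ha =>
    induction hb using Submodule.iSup_induction' with
    | zero => simp
    | add x y _ _ hx hy => rw [map_add]; exact add_mem hx hy
    | mem j b hb =>
      exact Submodule.mem_iSup_of_mem (i + j + 1)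
        (Submodule.subset_span ⟨i, j, rfl, a, ha, b, hb, rfl⟩)

end VertexOperatorAlgebra

theorem iSupIndep.mem_of_mem_iSup_of_le {ι R E : Type*} [Ring R] [AddCommGroup E] [Module R E]
    {p q : ι → Submodule R E} (hp : iSupIndep p) (hq : ∀ i, q i ≤ p i) {k : ι} {x : E}
    (hx : x ∈ p k) (hx' : x ∈ ⨆ i, q i) : x ∈ q k := by
  have hle : ⨆ i, q i ≤ q k ⊔ ⨆ (i) (_ : i ≠ k), p i := by
    refine iSup_le fun i => ?_
    by_cases h : i = k
    · subst h; exact le_sup_left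
    · exact ((hq i).trans (le_iSup₂_of_le i h le_rfl)).trans le_sup_right
  obtain ⟨y, hy, z, hz, rfl⟩ := Submodule.mem_sup.1 (hle hx')
  have hzk : z ∈ p k := by simpa using sub_mem hx (hq k hy)
  have : z = 0 := Submodule.disjoint_def.1 (hp k) z hzk hz
  simpa [this] using hy

namespace VertexOperatorAlgebra

variable {V : Type u} [AddCommGroup V] [Module ℂ V] (A : VertexOperatorAlgebra V)

/-- The decomposition `V = U + C₂(V)` in a fixed weight. -/
theorem weightSpace_le_sup {U : Submodule ℂ V} (hUgraded : A.IsGradedSubspace U)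
    (hU : IsCompl U (A.adjointModule.spaceC 2)) (k : ℕ) :
    A.weightSpace k ≤ (U ⊓ A.weightSpace k) ⊔ A.homogeneousC2 k := by
  intro x hx
  refine iSupIndep.mem_of_mem_iSup_of_le
    (q := fun n => (U ⊓ A.weightSpace n) ⊔ A.homogeneousC2 n) A.iSupIndep_weightSpace
    (fun i => sup_le inf_le_right (A.homogeneousC2_le_weightSpace i)) hx ?_
  have hx' : x ∈ U ⊔ A.adjointModule.spaceC 2 := by rw [hU.sup_eq_top]; trivial
  rw [iSup_sup_eq]
  refine sup_le_sup (le_of_eq hUgraded) A.spaceC_two_le hx'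

theorem finiteDimensional_of_isCompl {U : Submodule ℂ V} (hC2 : A.adjointModule.IsCFinite 2)
    (hU : IsCompl U (A.adjointModule.spaceC 2)) : FiniteDimensional ℂ U := by
  have : FiniteDimensional ℂ (V ⧸ A.adjointModule.spaceC 2) := hC2
  exact Module.Finite.equiv (Submodule.quotientEquivOfIsCompl _ _ hU.symm)

/-- If `V` is `C₂`-finite then `C₂(V)` contains all vectors of large weight. -/
theorem exists_weightSpace_le_homogeneousC2 {U : Submodule ℂ V}
    (hC2 : A.adjointModule.IsCFinite 2) (hUgraded : A.IsGradedSubspace U)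
    (hU : IsCompl U (A.adjointModule.spaceC 2)) :
    ∃ h : ℕ, ∀ k, h < k → A.weightSpace k ≤ A.homogeneousC2 k := by
  have hfd := A.finiteDimensional_of_isCompl hC2 hU
  have hfg : U.FG := (Submodule.fg_top U).1 hfd.fg_top
  obtain ⟨s, hs⟩ := CompleteLattice.IsCompactElement.exists_finset_of_le_iSup (Submodule ℂ V)
    ((Submodule.fg_iff_compact U).1 hfg) (fun n => U ⊓ A.weightSpace n) (le_of_eq hUgraded)
  refine ⟨s.sup id, fun k hk => (A.weightSpace_le_sup hUgraded hU k).trans (sup_le ?_ le_rfl)⟩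
  have hks : k ∉ s := fun h => absurd (Finset.le_sup (f := id) h) (by simpa using hk)
  have h1 : U ≤ ⨆ (i) (_ : i ≠ k), A.weightSpace i :=
    hs.trans (iSup₂_le fun i hi => inf_le_right.trans
      (le_iSup₂_of_le i (fun h => hks (h ▸ hi)) le_rfl))
  intro x hx
  have : x = 0 := Submodule.disjoint_def.1 (A.iSupIndep_weightSpace k) x hx.2 (h1 hx.1)
  simp [this]

end VertexOperatorAlgebra

/-! ### Words of modes -/

/-- A letter stands for the operator `a_[m]`. The weight of `a` is recorded as data; that `a` has this
weight is part of `ModeLetter.IsHomogeneous`. -/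
structure ModeLetter (V : Type u) where
  /-- The vector `a`. -/
  vec : V
  /-- The recorded weight of `a`. -/
  wt : ℕ
  /-- The index `m` of `a_[m]`. -/
  idx : ℤ

namespace ModeLetter

variable {V : Type u}

/-- The sum of the weights of the vectors in a word. -/
def totalWt (L : List (ModeLetter V)) : ℕ := (L.map wt).sum

/-- The degree of a word as an operator: `a_[m]` raises the conformal weight by `wt a + m`. -/
def degree (L : List (ModeLetter V)) : ℤ := (L.map fun x => (x.wt : ℤ) + x.idx).sum

/-- The sum of the squares of the indices in a word, which measures how far they are spread out. -/
def sqSum (L : List (ModeLetter V)) : ℤ := (L.map fun x => x.idx ^ 2).sum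

@[simp] theorem totalWt_nil : totalWt ([] : List (ModeLetter V)) = 0 := rfl

@[simp] theorem degree_nil : degree ([] : List (ModeLetter V)) = 0 := rfl

@[simp] theorem sqSum_nil : sqSum ([] : List (ModeLetter V)) = 0 := rfl

@[simp] theorem totalWt_cons (x : ModeLetter V) (L : List (ModeLetter V)) :
    totalWt (x :: L) = x.wt + totalWt L := by simp [totalWt]

@[simp] theorem degree_cons (x : ModeLetter V) (L : List (ModeLetter V)) :
    degree (x :: L) = x.wt + x.idx + degree L := by simp [degree]

@[simp] theorem sqSum_cons (x : ModeLetter V) (L : List (ModeLetter V)) :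
    sqSum (x :: L) = x.idx ^ 2 + sqSum L := by simp [sqSum]

@[simp] theorem totalWt_append (L L' : List (ModeLetter V)) :
    totalWt (L ++ L') = totalWt L + totalWt L' := by simp [totalWt]

@[simp] theorem degree_append (L L' : List (ModeLetter V)) :
    degree (L ++ L') = degree L + degree L' := by simp [degree]

@[simp] theorem sqSum_append (L L' : List (ModeLetter V)) :
    sqSum (L ++ L') = sqSum L + sqSum L' := by simp [sqSum]

theorem totalWt_perm {L L' : List (ModeLetter V)} (h : L.Perm L') : totalWt L = totalWt L' :=
  (h.map _).sum_eq

theorem degree_perm {L L' : List (ModeLetter V)} (h : L.Perm L') : degree L = degree L' :=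
  (h.map _).sum_eq

theorem sqSum_perm {L L' : List (ModeLetter V)} (h : L.Perm L') : sqSum L = sqSum L' :=
  (h.map _).sum_eq

theorem sum_idx_sub_sq (L : List (ModeLetter V)) (p : ℤ) :
    (L.map fun x => (x.idx - p) ^ 2).sum =
      sqSum L - 2 * p * (degree L - totalWt L) + L.length * p ^ 2 := by
  induction L with
  | nil => simp
  | cons x L ih =>
    simp only [List.map_cons, List.sum_cons, ih, sqSum_cons, degree_cons, totalWt_cons,
      List.length_cons]
    push_cast
    ring

/-- Among words whose indices have mean value `p`, the constant one has the least square sum. -/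
theorem length_mul_sq_lt_sqSum {L : List (ModeLetter V)} {p : ℤ}
    (hsum : degree L - totalWt L = L.length * p) (h : ∃ x ∈ L, x.idx ≠ p) :
    L.length * p ^ 2 < sqSum L := by
  obtain ⟨x, hx, hxp⟩ := h
  have h1 : (x.idx - p) ^ 2 ≤ (L.map fun x => (x.idx - p) ^ 2).sum :=
    List.single_le_sum (by simp only [List.mem_map]; rintro _ ⟨y, _, rfl⟩; positivity) _
      (List.mem_map.2 ⟨x, hx, rfl⟩)
  have h2 : 0 < (x.idx - p) ^ 2 := by
    have := sub_ne_zero.2 hxp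
    positivity
  rw [sum_idx_sub_sq, hsum] at h1
  nlinarith

theorem sqSum_eq_of_forall_idx_eq {L : List (ModeLetter V)} {p : ℤ} (h : ∀ x ∈ L, x.idx = p) :
    sqSum L = L.length * p ^ 2 := by
  induction L with
  | nil => simp
  | cons x L ih =>
    rw [sqSum_cons, ih fun y hy => h y (List.mem_cons_of_mem _ hy), h x List.mem_cons_self]
    simp only [List.length_cons]
    push_cast
    ring

theorem degree_eq_of_forall_idx_eq {L : List (ModeLetter V)} {p : ℤ} (h : ∀ x ∈ L, x.idx = p) :
    degree L = totalWt L + L.length * p := by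
  induction L with
  | nil => simp
  | cons x L ih =>
    rw [degree_cons, ih fun y hy => h y (List.mem_cons_of_mem _ hy), h x List.mem_cons_self]
    simp only [List.length_cons, totalWt_cons]
    push_cast
    ring

variable [AddCommGroup V] [Module ℂ V]

/-- A word is homogeneous if its letters carry vectors of the indicated weights, all positive. -/
def IsHomogeneous (A : VertexOperatorAlgebra V) (L : List (ModeLetter V)) : Prop :=
  ∀ x ∈ L, 0 < x.wt ∧ x.vec ∈ A.weightSpace x.wt

theorem IsHomogeneous.nil (A : VertexOperatorAlgebra V) : IsHomogeneous A [] := by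
  simp [IsHomogeneous]

theorem isHomogeneous_cons {A : VertexOperatorAlgebra V} {x : ModeLetter V}
    {L : List (ModeLetter V)} :
    IsHomogeneous A (x :: L) ↔ (0 < x.wt ∧ x.vec ∈ A.weightSpace x.wt) ∧ IsHomogeneous A L := by
  simp [IsHomogeneous]

theorem isHomogeneous_append {A : VertexOperatorAlgebra V} {L L' : List (ModeLetter V)} :
    IsHomogeneous A (L ++ L') ↔ IsHomogeneous A L ∧ IsHomogeneous A L' := by
  simp only [IsHomogeneous, List.mem_append]
  exact ⟨fun h => ⟨fun x hx => h x (.inl hx), fun x hx => h x (.inr hx)⟩,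
    fun h x hx => hx.elim (h.1 x) (h.2 x)⟩

theorem IsHomogeneous.perm {A : VertexOperatorAlgebra V} {L L' : List (ModeLetter V)}
    (hL : IsHomogeneous A L) (h : L.Perm L') : IsHomogeneous A L' :=
  fun x hx => hL x (h.mem_iff.2 hx)

theorem IsHomogeneous.length_le {A : VertexOperatorAlgebra V} {L : List (ModeLetter V)}
    (hL : IsHomogeneous A L) : L.length ≤ totalWt L := by
  induction L with
  | nil => simp
  | cons x L ih =>
    obtain ⟨hx, hL⟩ := isHomogeneous_cons.1 hL
    have := ih hL
    simp only [List.length_cons, totalWt_cons]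
    omega

/-- Homogeneous words of weight less than `s` and degree `D`. -/
def lowerWords (A : VertexOperatorAlgebra V) (s : ℕ) (D : ℤ) : Set (List (ModeLetter V)) :=
  {L | IsHomogeneous A L ∧ totalWt L < s ∧ degree L = D}

end ModeLetter

open ModeLetter

/-! ### Words acting on a module, modulo lower weight -/

namespace WeakVOAModule

variable {V : Type u} {W : Type v} [AddCommGroup V] [Module ℂ V] [AddCommGroup W] [Module ℂ W]
  {A : VertexOperatorAlgebra V} (M : WeakVOAModule A W)

/-- The operator on `W` given by a word, the last letter acting first. -/
def wordAction (L : List (ModeLetter V)) : Module.End ℂ W :=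
  (L.map fun x => fieldCoeff M.Y x.vec x.idx).prod

@[simp] theorem wordAction_nil (w : W) : M.wordAction [] w = w := by simp [wordAction]

@[simp] theorem wordAction_cons (x : ModeLetter V) (L : List (ModeLetter V)) (w : W) :
    M.wordAction (x :: L) w = fieldCoeff M.Y x.vec x.idx (M.wordAction L w) := by
  simp [wordAction]

@[simp] theorem wordAction_append (L L' : List (ModeLetter V)) (w : W) :
    M.wordAction (L ++ L') w = M.wordAction L (M.wordAction L' w) := by
  simp [wordAction]

/-- The subspace spanned by the words in `S` applied to `w`. -/
def wordSpan (S : Set (List (ModeLetter V))) (w : W) : Submodule ℂ W :=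
  Submodule.span ℂ ((fun L => M.wordAction L w) '' S)

variable {M}

theorem wordAction_mem_wordSpan {S : Set (List (ModeLetter V))} {L : List (ModeLetter V)}
    (hL : L ∈ S) (w : W) : M.wordAction L w ∈ M.wordSpan S w :=
  Submodule.subset_span ⟨L, hL, rfl⟩

theorem wordSpan_mono {S T : Set (List (ModeLetter V))} (h : S ⊆ T) (w : W) :
    M.wordSpan S w ≤ M.wordSpan T w :=
  Submodule.span_mono (Set.image_mono h)

theorem wordAction_mem_wordSpan_of_mem {S T : Set (List (ModeLetter V))} {L : List (ModeLetter V)}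
    (h : ∀ L' ∈ S, L ++ L' ∈ T) {x w : W} (hx : x ∈ M.wordSpan S w) :
    M.wordAction L x ∈ M.wordSpan T w := by
  induction hx using Submodule.span_induction with
  | mem x hx =>
    obtain ⟨L', hL', rfl⟩ := hx
    simpa using wordAction_mem_wordSpan (M := M) (h L' hL') w
  | zero => simp
  | add x y _ _ hx hy => rw [map_add]; exact add_mem hx hy
  | smul c x _ hx => rw [map_smul]; exact Submodule.smul_mem _ _ hx

theorem wordSpan_wordAction_le {S T : Set (List (ModeLetter V))} {L : List (ModeLetter V)}
    (h : ∀ L' ∈ S, L' ++ L ∈ T) (w : W) :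
    M.wordSpan S (M.wordAction L w) ≤ M.wordSpan T w := by
  refine Submodule.span_le.2 ?_
  rintro _ ⟨L', hL', rfl⟩
  simpa using wordAction_mem_wordSpan (M := M) (h L' hL') w

/-- Applying `a_[m]`, where `a` may have weight `0`, lengthens words by a word of weight `wt a`. In
weight `0` the operator `a_[m]` is a multiple of `1` if `m = 0`, and zero otherwise. -/
theorem fieldCoeff_mem_wordSpan
    (hV0 : A.weightSpace 0 = Submodule.span ℂ {A.vacuum}) {S T : Set (List (ModeLetter V))}
    {k : ℕ} {a : V} (ha : a ∈ A.weightSpace k) {m : ℤ} {x w : W}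
    (h : ∀ L ∈ S, ∀ L', IsHomogeneous A L' → totalWt L' = k → degree L' = k + m → L' ++ L ∈ T)
    (hx : x ∈ M.wordSpan S w) : fieldCoeff M.Y a m x ∈ M.wordSpan T w := by
  rcases Nat.eq_zero_or_pos k with rfl | hk
  · rw [hV0] at ha
    obtain ⟨c, rfl⟩ := Submodule.mem_span_singleton.1 ha
    rw [fieldCoeff_smul, LinearMap.smul_apply]
    refine Submodule.smul_mem _ _ ?_
    rw [fieldCoeff, M.vacuum_mode]
    split_ifs with hm
    · refine wordSpan_mono (fun L hL => ?_) w hx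
      exact h L hL [] (IsHomogeneous.nil A) rfl (by simp; omega)
    · simp
  · have := wordAction_mem_wordSpan_of_mem (M := M) (L := [⟨a, k, m⟩]) (T := T) (fun L hL =>
      h L hL _ (by simpa [IsHomogeneous] using ⟨hk, ha⟩) (by simp) (by simp)) hx
    simpa using this

theorem mem_wordSpan_nil (w : W) : w ∈ M.wordSpan {[]} w := by
  simpa using wordAction_mem_wordSpan (M := M) (Set.mem_singleton []) w

theorem finsum_mem {ι : Type*} {p : Submodule ℂ W} {f : ι → W} (h : ∀ i, f i ∈ p) :
    ∑ᶠ i, f i ∈ p :=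
  finsum_induction (· ∈ p) p.zero_mem (fun _ _ => p.add_mem) h

/-- Interchanging two operators changes the result by terms of lower weight. -/
theorem commutator_mem_wordSpan
    (hV0 : A.weightSpace 0 = Submodule.span ℂ {A.vacuum})
    {k l : ℕ} {a b : V} (ha : a ∈ A.weightSpace k) (hb : b ∈ A.weightSpace l) (m n : ℤ) (w : W) :
    fieldCoeff M.Y a m (fieldCoeff M.Y b n w) - fieldCoeff M.Y b n (fieldCoeff M.Y a m w) ∈
      M.wordSpan (lowerWords A (k + l) (k + m + (l + n))) w := by
  rw [fieldCoeff, fieldCoeff, M.borcherds.commutator]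
  refine finsum_mem fun i => zsmul_mem ?_ _
  rcases lt_or_ge ((k : ℤ) + l - i - 1) 0 with hneg | hnn
  · rw [A.mode_eq_zero_of_neg ha hb hneg, fieldMode_zero]
    simp
  · obtain ⟨r, hr⟩ := Int.eq_ofNat_of_zero_le hnn
    rw [show -m - 1 + (-n - 1) - (i : ℤ) = -(m + n + 1 + i) - 1 by ring]
    refine fieldCoeff_mem_wordSpan (S := {[]}) hV0 (A.mode_mem_weightSpace ha hb hr.symm) ?_
      (mem_wordSpan_nil w)
    rintro _ rfl L' h1 h2 h3
    exact ⟨by simpa using h1, by simp; omega, by simp; omega⟩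

/-- Up to terms of lower weight, the letters of a word may be permuted. -/
theorem wordAction_sub_mem_of_perm
    (hV0 : A.weightSpace 0 = Submodule.span ℂ {A.vacuum}) {L L' : List (ModeLetter V)}
    (hL : IsHomogeneous A L) (h : L.Perm L') (w : W) :
    M.wordAction L w - M.wordAction L' w ∈ M.wordSpan (lowerWords A (totalWt L) (degree L)) w := by
  induction h with
  | nil => simp
  | @cons x l₁ l₂ h ih =>
    obtain ⟨hx, hL⟩ := isHomogeneous_cons.1 hL
    have := wordAction_mem_wordSpan_of_mem (M := M) (L := [x])
      (T := lowerWords A (totalWt (x :: l₁)) (degree (x :: l₁))) ?_ (ih hL)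
    · simpa using this
    · rintro K ⟨h1, h2, h3⟩
      exact ⟨isHomogeneous_cons.2 ⟨hx, h1⟩, by simpa using h2, by simpa using h3⟩
  | swap x y L =>
    simp only [isHomogeneous_cons] at hL
    obtain ⟨hy, hx, hL⟩ := hL
    simp only [wordAction_cons]
    refine wordSpan_wordAction_le ?_ w (commutator_mem_wordSpan hV0 hy.2 hx.2 _ _ _)
    rintro K ⟨h1, h2, h3⟩
    refine ⟨isHomogeneous_append.2 ⟨h1, hL⟩, ?_, ?_⟩
    · simp; omega
    · simp; omega
  | trans h₁ h₂ ih₁ ih₂ =>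
    have := ih₂ (hL.perm h₁)
    rw [← totalWt_perm h₁, ← degree_perm h₁] at this
    simpa using add_mem (ih₁ hL) this

/-- The modes of an element of `C₂(V)` are sums of terms of lower weight. -/
theorem fieldCoeff_mem_of_mem_homogeneousC2
    (hV0 : A.weightSpace 0 = Submodule.span ℂ {A.vacuum}) {k : ℕ} {c : V}
    (hc : c ∈ A.homogeneousC2 k) (m : ℤ) (w : W) :
    fieldCoeff M.Y c m w ∈ M.wordSpan (lowerWords A k (k + m)) w := by
  have key : ∀ {i j : ℕ} {a b : V}, a ∈ A.weightSpace i → b ∈ A.weightSpace j → ∀ n₁ n₂ : ℤ,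
      i + j < k → (i : ℤ) + j + n₁ + n₂ = k + m →
      fieldCoeff M.Y a n₁ (fieldCoeff M.Y b n₂ w) ∈ M.wordSpan (lowerWords A k (k + m)) w := by
    intro i j a b ha hb n₁ n₂ h1 h2
    refine fieldCoeff_mem_wordSpan hV0 (S := {L | IsHomogeneous A L ∧ totalWt L = j ∧
      degree L = j + n₂}) ha ?_ (fieldCoeff_mem_wordSpan hV0 (S := {[]}) hb ?_ (mem_wordSpan_nil w))
    · rintro L ⟨h3, h4, h5⟩ L' h6 h7 h8
      exact ⟨isHomogeneous_append.2 ⟨h6, h3⟩, by simp; omega, by simp; omega⟩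
    · rintro _ rfl L' h6 h7 h8
      exact ⟨by simpa using h6, by simpa using h7, by simpa using h8⟩
  induction hc using Submodule.span_induction with
  | zero => simp [fieldCoeff_zero]
  | add x y _ _ hx hy => rw [fieldCoeff_add]; exact add_mem hx hy
  | smul c x _ hx => rw [fieldCoeff_smul]; exact Submodule.smul_mem _ _ hx
  | mem x hx =>
    obtain ⟨i, j, hij, a, ha, b, hb, rfl⟩ := hx
    rw [fieldCoeff, M.borcherds.associativity]
    refine finsum_mem fun t => zsmul_mem (sub_mem ?_ (Submodule.smul_mem _ _ ?_)) _
    · have := key ha hb (1 + t) (m - t) (by omega) (by omega)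
      simp only [fieldCoeff] at this
      convert this using 3 <;> ring_nf
    · have := key hb ha (m + 2 + t) (-1 - t) (by omega) (by omega)
      simp only [fieldCoeff] at this
      convert this using 3 <;> ring_nf

end WeakVOAModule

/-! ### Normally ordered products and words with constant index -/

namespace ModeLetter

variable {V : Type u} [AddCommGroup V] [Module ℂ V]

/-- The iterated normally ordered product `a₁(-1)a₂(-1)⋯aₜ(-1)𝟏` of the vectors of a word. -/
def normalProduct (A : VertexOperatorAlgebra V) (L : List (ModeLetter V)) : V :=
  L.foldr (fun x v => fieldMode A.Y x.vec (-1) v) A.vacuum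

@[simp] theorem normalProduct_cons (A : VertexOperatorAlgebra V) (x : ModeLetter V)
    (L : List (ModeLetter V)) :
    normalProduct A (x :: L) = fieldMode A.Y x.vec (-1) (normalProduct A L) := rfl

theorem normalProduct_mem_weightSpace {A : VertexOperatorAlgebra V} {L : List (ModeLetter V)}
    (hL : IsHomogeneous A L) : normalProduct A L ∈ A.weightSpace (totalWt L) := by
  induction L with
  | nil => exact A.vacuum_mem_weightSpace
  | cons x L ih =>
    obtain ⟨hx, hL⟩ := isHomogeneous_cons.1 hL
    exact A.mode_mem_weightSpace hx.2 (ih hL) (by simp)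

/-- Homogeneous words of degree `D` that have either weight less than `s`, or weight `s` and length
`t`. -/
def productWords (A : VertexOperatorAlgebra V) (s t : ℕ) (D : ℤ) : Set (List (ModeLetter V)) :=
  {L | IsHomogeneous A L ∧ degree L = D ∧ (totalWt L < s ∨ totalWt L = s ∧ L.length = t)}

/-- Homogeneous words of degree `D` that have either weight less than `s`, or weight `s` and square
sum of the indices greater than `E`. -/
def spreadWords (A : VertexOperatorAlgebra V) (s : ℕ) (D E : ℤ) : Set (List (ModeLetter V)) :=
  {L | IsHomogeneous A L ∧ degree L = D ∧ (totalWt L < s ∨ totalWt L = s ∧ E < sqSum L)}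

theorem lowerWords_subset_spreadWords (A : VertexOperatorAlgebra V) (s : ℕ) (D E : ℤ) :
    lowerWords A s D ⊆ spreadWords A s D E :=
  fun _ h => ⟨h.1, h.2.2, .inl h.2.1⟩

end ModeLetter

namespace WeakVOAModule

variable {V : Type u} {W : Type v} [AddCommGroup V] [Module ℂ V] [AddCommGroup W] [Module ℂ W]
  {A : VertexOperatorAlgebra V} {M : WeakVOAModule A W}

theorem fieldCoeff_normalProduct_mem {L : List (ModeLetter V)} (hL : IsHomogeneous A L) (m : ℤ)
    (w : W) : fieldCoeff M.Y (normalProduct A L) m w ∈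
      M.wordSpan (productWords A (totalWt L) L.length (totalWt L + m)) w := by
  induction L generalizing m w with
  | nil =>
    change fieldMode M.Y A.vacuum _ w ∈ _
    rw [M.vacuum_mode]
    split_ifs with hm
    · simpa using wordAction_mem_wordSpan (M := M) (L := [])
        (S := productWords A 0 0 (0 + m)) ⟨IsHomogeneous.nil A, by simp; omega, by simp⟩ w
    · simp
  | cons x L ih =>
    obtain ⟨hx, hL⟩ := isHomogeneous_cons.1 hL
    rw [normalProduct_cons, M.borcherds.fieldCoeff_normalProduct]
    refine finsum_mem fun i => add_mem ?_ ?_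
    · have := wordAction_mem_wordSpan_of_mem (M := M) (L := [⟨x.vec, x.wt, i⟩])
        (T := productWords A (totalWt (x :: L)) (x :: L).length (totalWt (x :: L) + m)) ?_
        (ih hL (m - i) w)
      · simpa using this
      · rintro K ⟨h1, h2, h3⟩
        refine ⟨isHomogeneous_cons.2 ⟨hx, h1⟩, by simp; omega, ?_⟩
        simp only [List.singleton_append, totalWt_cons, List.length_cons]
        omega
    · have := wordSpan_wordAction_le (M := M) (L := [⟨x.vec, x.wt, -1 - i⟩])
        (T := productWords A (totalWt (x :: L)) (x :: L).length (totalWt (x :: L) + m)) ?_ w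
        (x := fieldCoeff M.Y (normalProduct A L) (m + 1 + i)
          (M.wordAction [⟨x.vec, x.wt, -1 - i⟩] w)) (ih hL _ _)
      · simpa using this
      · rintro K ⟨h1, h2, h3⟩
        refine ⟨isHomogeneous_append.2 ⟨h1, isHomogeneous_cons.2 ⟨hx, IsHomogeneous.nil A⟩⟩,
          by simp; omega, ?_⟩
        simp only [totalWt_append, totalWt_cons, totalWt_nil, List.length_append, List.length_cons,
          List.length_nil]
        omega

theorem finsum_sub_mem {p : Submodule ℂ W} {f : ℕ → W} (hf : (Function.support f).Finite) {y : W}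
    (i : ℕ) (hi : f i - y ∈ p) (h : ∀ j, j ≠ i → f j ∈ p) : ∑ᶠ j, f j - y ∈ p := by
  rw [finsum_eq_sum_of_support_subset (s := insert i hf.toFinset) f (by simp),
    ← Finset.add_sum_erase _ _ (Finset.mem_insert_self i _), add_sub_right_comm]
  exact add_mem hi (Submodule.sum_mem _ fun j hj => h j (Finset.ne_of_mem_erase hj))

/-- A word with constant index `p` is a mode of a normally ordered product, up to terms of lower
weight and words of the same weight whose indices are more spread out. -/
theorem fieldCoeff_normalProduct_sub_mem
    (hV0 : A.weightSpace 0 = Submodule.span ℂ {A.vacuum}) {L : List (ModeLetter V)}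
    (hL : IsHomogeneous A L) {p : ℤ} (hp : ∀ x ∈ L, x.idx = p) (w : W) :
    fieldCoeff M.Y (normalProduct A L) (L.length * p) w - M.wordAction L w ∈
      M.wordSpan (spreadWords A (totalWt L) (degree L) (sqSum L)) w := by
  induction L generalizing w with
  | nil =>
    have : fieldCoeff M.Y (normalProduct A []) (([] : List (ModeLetter V)).length * p) w = w := by
      change fieldMode M.Y A.vacuum _ w = w
      simp [M.vacuum_mode]
    rw [this]
    simp
  | cons x L ih =>
    have hdeg := degree_eq_of_forall_idx_eq hp
    have hsq := sqSum_eq_of_forall_idx_eq hp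
    have hhom := hL
    obtain ⟨hx, hL⟩ := isHomogeneous_cons.1 hL
    have hp' : ∀ y ∈ L, y.idx = p := fun y hy => hp y (List.mem_cons_of_mem _ hy)
    have hdegL := degree_eq_of_forall_idx_eq hp'
    have hxp : x.idx = p := hp x List.mem_cons_self
    -- A word with a letter of index `j ≠ p` at either end is more spread out.
    have hspread : ∀ j : ℤ, j ≠ p → ∀ K ∈ productWords A (totalWt L) L.length
        (totalWt L + ((x :: L).length * p - j)), ∀ K' : List (ModeLetter V),
        K'.Perm (⟨x.vec, x.wt, j⟩ :: K) →
        K' ∈ spreadWords A (totalWt (x :: L)) (degree (x :: L)) (sqSum (x :: L)) := by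
      rintro j hj K ⟨h1, h2, h3⟩ K' hK'
      have h4 : IsHomogeneous A (⟨x.vec, x.wt, j⟩ :: K) := isHomogeneous_cons.2 ⟨hx, h1⟩
      have h5 : degree (⟨x.vec, x.wt, j⟩ :: K) = degree (x :: L) := by
        rw [hdeg, degree_cons, h2, totalWt_cons]
        push_cast
        ring
      refine ⟨h4.perm hK'.symm, by rw [degree_perm hK', h5], ?_⟩
      rw [totalWt_perm hK', sqSum_perm hK']
      rcases h3 with h3 | ⟨h3, h3'⟩
      · left
        simpa using h3
      · right
        have h6 : totalWt (⟨x.vec, x.wt, j⟩ :: K) = totalWt (x :: L) := by simpa using h3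
        have h7 : (⟨x.vec, x.wt, j⟩ :: K).length = (x :: L).length := by simpa using h3'
        refine ⟨h6, ?_⟩
        rw [hsq, ← h7]
        refine length_mul_sq_lt_sqSum ?_ ⟨_, List.mem_cons_self, hj⟩
        rw [h5, h6, h7, hdeg]
        ring
    have hfirst : ∀ i : ℤ, i ≠ p →
        fieldCoeff M.Y x.vec i (fieldCoeff M.Y (normalProduct A L) ((x :: L).length * p - i) w) ∈
        M.wordSpan (spreadWords A (totalWt (x :: L)) (degree (x :: L)) (sqSum (x :: L))) w := by
      intro i hi
      have := wordAction_mem_wordSpan_of_mem (M := M) (L := [⟨x.vec, x.wt, i⟩])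
        (fun K hK => hspread i hi K hK _ (List.Perm.refl _))
        (fieldCoeff_normalProduct_mem (M := M) hL ((x :: L).length * p - i) w)
      simpa using this
    have hsecond : ∀ i : ℤ, i ≠ p →
        fieldCoeff M.Y (normalProduct A L) ((x :: L).length * p - i) (fieldCoeff M.Y x.vec i w) ∈
        M.wordSpan (spreadWords A (totalWt (x :: L)) (degree (x :: L)) (sqSum (x :: L))) w := by
      intro i hi
      have := wordSpan_wordAction_le (M := M) (L := [⟨x.vec, x.wt, i⟩])
        (fun K hK => hspread i hi K hK _ (List.perm_append_singleton _ _)) w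
        (fieldCoeff_normalProduct_mem (M := M) hL ((x :: L).length * p - i) _)
      simpa using this
    have hlen : (x :: L).length * p - p = L.length * p := by
      simp only [List.length_cons]
      push_cast
      ring
    have hone : ∀ K ∈ spreadWords A (totalWt L) (degree L) (sqSum L),
        ∀ K' : List (ModeLetter V), K'.Perm (x :: K) →
        K' ∈ spreadWords A (totalWt (x :: L)) (degree (x :: L)) (sqSum (x :: L)) := by
      rintro K ⟨h1, h2, h3⟩ K' hK'
      refine ⟨IsHomogeneous.perm (isHomogeneous_cons.2 ⟨hx, h1⟩) hK'.symm,
        by rw [degree_perm hK']; simpa using h2, ?_⟩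
      rw [totalWt_perm hK', sqSum_perm hK']
      simpa using h3
    rw [normalProduct_cons, M.borcherds.fieldCoeff_normalProduct]
    -- The word itself occurs in the term in which `x` has index `p`. It stands on the left if
    -- `0 ≤ p`, and has to be moved there from the right otherwise.
    have hfin := finite_support_normalProduct M.Y x.vec (normalProduct A L) w ((x :: L).length * p)
    have harg : ∀ i : ℕ, ((x :: L).length * p + 1 + i : ℤ) = (x :: L).length * p - (-1 - i) :=
      fun i => by ring
    rcases lt_or_ge p 0 with hneg | hnn
    · obtain ⟨i, hi⟩ := Int.eq_ofNat_of_zero_le (show 0 ≤ -1 - p by omega)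
      refine finsum_sub_mem hfin i ?_ fun j hj => add_mem (hfirst _ (by omega)) ?_
      · rw [add_sub_assoc]
        refine add_mem (hfirst _ (by omega)) ?_
        rw [harg, show (-1 - (i : ℤ)) = p by omega, hlen]
        have h1 := wordSpan_wordAction_le (M := M) (L := [x])
          (fun K hK => hone K hK _ (List.perm_append_singleton _ _)) w (ih hL hp' _)
        have h2 := wordSpan_mono (M := M) (lowerWords_subset_spreadWords A _ _ (sqSum (x :: L))) w
          (wordAction_sub_mem_of_perm (M := M) hV0 hhom (List.perm_append_singleton x L).symm w)
        have := sub_mem h1 h2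
        simpa [hxp] using this
      · rw [harg]
        exact hsecond _ (by omega)
    · obtain ⟨i, hi⟩ := Int.eq_ofNat_of_zero_le hnn
      refine finsum_sub_mem hfin i ?_ fun j hj => add_mem (hfirst _ (by omega)) ?_
      · rw [add_sub_right_comm]
        refine add_mem ?_ ?_
        · have h1 := wordAction_mem_wordSpan_of_mem (M := M) (L := [x])
            (fun K hK => hone K hK _ (List.Perm.refl _)) (ih hL hp' w)
          rw [← hi, hlen]
          simpa [hxp] using h1
        · rw [harg]
          exact hsecond _ (by omega)
      · rw [harg]
        exact hsecond _ (by omega)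

end WeakVOAModule

/-! ### Words of large degree -/

namespace ModeLetter

variable {V : Type u}

theorem degree_le_sum_countP {h N : ℕ} {L : List (ModeLetter V)} (hwt : ∀ x ∈ L, x.wt ≤ h)
    (hidx : ∀ x ∈ L, x.idx < N) :
    degree L ≤ ∑ p ∈ Finset.Ioo (-(h : ℤ)) N, (L.countP (·.idx = p) : ℤ) * (h + N) := by
  induction L with
  | nil => simp
  | cons x L ih =>
    have hL := ih (fun y hy => hwt y (List.mem_cons_of_mem _ hy))
      (fun y hy => hidx y (List.mem_cons_of_mem _ hy))
    have h1 := hwt x List.mem_cons_self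
    have h2 := hidx x List.mem_cons_self
    -- A letter with `idx ≤ -h` is not counted, but contributes at most `0` to the degree.
    have hx : (x.wt : ℤ) + x.idx ≤
        ∑ p ∈ Finset.Ioo (-(h : ℤ)) N, if x.idx = p then ((h : ℤ) + N) else 0 := by
      rw [Finset.sum_ite_eq]
      simp only [Finset.mem_Ioo]
      split_ifs <;> omega
    refine (add_le_add hx hL).trans (le_of_eq ?_)
    rw [← Finset.sum_add_distrib]
    refine Finset.sum_congr rfl fun p _ => ?_
    rw [List.countP_cons]
    by_cases hp : x.idx = p
    · simp [hp]; ring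
    · simp [hp]

/-- A word of large degree whose weights and indices are bounded above repeats some index. -/
theorem exists_lt_countP_of_lt_degree {h N : ℕ} {L : List (ModeLetter V)}
    (hwt : ∀ x ∈ L, x.wt ≤ h) (hidx : ∀ x ∈ L, x.idx < N)
    (hdeg : (h : ℤ) * (h + N) ^ 2 < degree L) : ∃ p : ℤ, h < L.countP (·.idx = p) := by
  by_contra! hcon
  refine absurd hdeg (not_lt.2 ((degree_le_sum_countP hwt hidx).trans ?_))
  calc ∑ p ∈ Finset.Ioo (-(h : ℤ)) N, (L.countP (·.idx = p) : ℤ) * (h + N)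
      ≤ ∑ p ∈ Finset.Ioo (-(h : ℤ)) N, (h : ℤ) * (h + N) :=
        Finset.sum_le_sum fun p _ =>
          mul_le_mul_of_nonneg_right (by exact_mod_cast hcon p) (by positivity)
    _ ≤ (h + N : ℤ) * (h * (h + N)) := by
        rw [Finset.sum_const, Int.card_Ioo, nsmul_eq_mul]
        exact mul_le_mul_of_nonneg_right (by omega) (by positivity)
    _ = h * (h + N) ^ 2 := by ring

/-- If all indices are less than `N`, their sum and their number bound the sum of their squares. -/
theorem sqSum_le_of_forall_idx_lt {N : ℕ} {L : List (ModeLetter V)}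
    (hidx : ∀ x ∈ L, x.idx < N) :
    sqSum L ≤ 2 * (L.length * N - (degree L - totalWt L)) ^ 2 + 2 * L.length * N ^ 2 := by
  suffices 0 ≤ L.length * N - (degree L - totalWt L) ∧
      sqSum L ≤ 2 * (L.length * N - (degree L - totalWt L)) ^ 2 + 2 * L.length * N ^ 2 from this.2
  induction L with
  | nil => simp
  | cons x L ih =>
    obtain ⟨h1, h2⟩ := ih (fun y hy => hidx y (List.mem_cons_of_mem _ hy))
    have h3 := hidx x List.mem_cons_self
    simp only [List.length_cons, degree_cons, totalWt_cons, sqSum_cons]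
    push_cast
    set S : ℤ := L.length * N - (degree L - totalWt L) with hS
    have h4 : ((L.length + 1) * N - (x.wt + x.idx + degree L - (x.wt + totalWt L)) : ℤ) =
        S + (N - x.idx) := by rw [hS]; ring
    rw [h4]
    refine ⟨by omega, ?_⟩
    nlinarith [mul_nonneg h1 (show (0 : ℤ) ≤ N - x.idx by omega), sq_nonneg ((x.idx : ℤ) - 2 * N)]

theorem idx_le_degree {L : List (ModeLetter V)} (hL : ∀ x ∈ L, 0 ≤ x.idx) :
    0 ≤ degree L ∧ ∀ x ∈ L, x.idx ≤ degree L := by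
  induction L with
  | nil => simp
  | cons x L ih =>
    obtain ⟨h1, h2⟩ := ih fun y hy => hL y (List.mem_cons_of_mem _ hy)
    have h3 := hL x List.mem_cons_self
    simp only [List.mem_cons, forall_eq_or_imp, degree_cons]
    exact ⟨by omega, by omega, fun y hy => by have := h2 y hy; omega⟩

theorem totalWt_le_degree {L : List (ModeLetter V)} (hL : ∀ x ∈ L, 0 ≤ x.idx) :
    (totalWt L : ℤ) ≤ degree L := by
  induction L with
  | nil => simp
  | cons x L ih =>
    have h1 := ih fun y hy => hL y (List.mem_cons_of_mem _ hy)
    have h3 := hL x List.mem_cons_self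
    simp only [degree_cons, totalWt_cons]
    push_cast
    omega

end ModeLetter

namespace WeakVOAModule

variable {V : Type u} {W : Type v} [AddCommGroup V] [Module ℂ V] [AddCommGroup W] [Module ℂ W]
  {A : VertexOperatorAlgebra V} {M : WeakVOAModule A W}

theorem fieldCoeff_mem_spaceCRel {U : Submodule ℂ V} {u : V} (hu : u ∈ U) {m : ℕ} {n : ℤ}
    (hn : (m : ℤ) ≤ n + 1) (w : W) : fieldCoeff M.Y u n w ∈ M.spaceCRel U m := by
  refine Submodule.subset_span ⟨u, hu, w, (n + 1).toNat, by omega, ?_⟩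
  rw [fieldCoeff]
  congr 2
  omega

theorem wordSpan_le {S : Set (List (ModeLetter V))} {w : W} {p : Submodule ℂ W}
    (h : ∀ L ∈ S, M.wordAction L w ∈ p) : M.wordSpan S w ≤ p := by
  refine Submodule.span_le.2 ?_
  rintro _ ⟨L, hL, rfl⟩
  exact h L hL

/-- A word beginning with a mode of an element of `C₂(V)` is a sum of words of lower weight. -/
theorem fieldCoeff_wordAction_mem_of_mem_homogeneousC2
    (hV0 : A.weightSpace 0 = Submodule.span ℂ {A.vacuum}) {k : ℕ} {c : V}
    (hc : c ∈ A.homogeneousC2 k) (n : ℤ) {L : List (ModeLetter V)} (hL : IsHomogeneous A L)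
    (w : W) : fieldCoeff M.Y c n (M.wordAction L w) ∈
      M.wordSpan (lowerWords A (k + totalWt L) (k + n + degree L)) w := by
  refine wordSpan_wordAction_le ?_ w (fieldCoeff_mem_of_mem_homogeneousC2 hV0 hc n _)
  rintro K ⟨h1, h2, h3⟩
  exact ⟨isHomogeneous_append.2 ⟨h1, hL⟩, by simpa using h2, by simpa using h3⟩

theorem wordAction_mem_of_perm
    (hV0 : A.weightSpace 0 = Submodule.span ℂ {A.vacuum}) {L L' : List (ModeLetter V)}
    (hL : IsHomogeneous A L) (h : L.Perm L') {w : W} {p : Submodule ℂ W}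
    (hp : M.wordSpan (lowerWords A (totalWt L) (degree L)) w ≤ p)
    (hL' : M.wordAction L' w ∈ p) : M.wordAction L w ∈ p := by
  simpa using add_mem (hp (wordAction_sub_mem_of_perm (M := M) hV0 hL h w)) hL'

/-- Words of large degree map `W` into `C_m(U, W)`. The proof is by induction on the weight of the
word and, for fixed weight, by descending induction on the sum of the squares of its indices. This
sum is bounded as long as no index is so large that the word lies in `C_m(U, W)` anyway. -/
theorem wordAction_mem_spaceCRel
    (hV0 : A.weightSpace 0 = Submodule.span ℂ {A.vacuum}) {U : Submodule ℂ V}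
    (hU : ∀ k, A.weightSpace k ≤ (U ⊓ A.weightSpace k) ⊔ A.homogeneousC2 k) {h : ℕ}
    (hh : ∀ k, h < k → A.weightSpace k ≤ A.homogeneousC2 k) (m : ℕ)
    {L : List (ModeLetter V)} (hL : IsHomogeneous A L)
    (hdeg : (h : ℤ) * (h + m) ^ 2 < degree L) (w : W) :
    M.wordAction L w ∈ M.spaceCRel U m := by
  obtain ⟨s, hs⟩ : ∃ s, totalWt L = s := ⟨_, rfl⟩
  induction s using Nat.strong_induction_on generalizing L w with
  | _ s ihs =>
  obtain ⟨D, hD⟩ : ∃ D, degree L = D := ⟨_, rfl⟩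
  rw [hD] at hdeg
  have hlower : ∀ w, M.wordSpan (lowerWords A s D) w ≤ M.spaceCRel U m := fun w =>
    wordSpan_le fun K hK => ihs _ hK.2.1 hK.1 (by rw [hK.2.2]; exact hdeg) w rfl
  obtain ⟨B, hB⟩ : ∃ B : ℤ, ∀ K : List (ModeLetter V), IsHomogeneous A K → totalWt K = s →
      degree K = D → (∀ x ∈ K, x.idx < m) → sqSum K ≤ B := by
    -- The length is at most the weight `s`, and the indices sum to `D - s`.
    refine ⟨2 * (s * m + |D - s|) ^ 2 + 2 * s * m ^ 2, fun K h1 h2 h3 h4 => ?_⟩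
    refine (sqSum_le_of_forall_idx_lt h4).trans ?_
    have hlen : (K.length : ℤ) ≤ s := by have := h1.length_le; omega
    have hlen' : (K.length * m : ℤ) ≤ s * m := mul_le_mul_of_nonneg_right hlen (by positivity)
    rw [h2, h3]
    refine add_le_add (mul_le_mul_of_nonneg_left (sq_le_sq' ?_ ?_) (by norm_num)) ?_
    · have : (0 : ℤ) ≤ K.length * m := by positivity
      have := le_abs_self (D - s)
      have : (0 : ℤ) ≤ s * m := by positivity
      linarith
    · have := neg_abs_le (D - s)
      linarith
    · gcongr
  obtain ⟨r, hr⟩ : ∃ r, (B + 1 - sqSum L).toNat = r := ⟨_, rfl⟩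
  induction r using Nat.strong_induction_on generalizing L w with
  | _ r ihr =>
  by_cases hlarge : ∃ x ∈ L, (m : ℤ) ≤ x.idx
  · obtain ⟨x, hxL, hxm⟩ := hlarge
    obtain ⟨L₁, L₂, rfl⟩ := List.append_of_mem hxL
    have hperm : (L₁ ++ x :: L₂).Perm (x :: (L₁ ++ L₂)) := List.perm_middle
    have hhom := hL.perm hperm
    obtain ⟨hx, hK⟩ := isHomogeneous_cons.1 hhom
    refine wordAction_mem_of_perm hV0 hL hperm (by rw [hs, hD]; exact hlower w) ?_
    obtain ⟨u, hu, c, hc, huc⟩ := Submodule.mem_sup.1 (hU _ hx.2)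
    rw [wordAction_cons, ← huc, fieldCoeff_add, LinearMap.add_apply]
    refine add_mem (fieldCoeff_mem_spaceCRel hu.1 (by omega) _) ?_
    have := fieldCoeff_wordAction_mem_of_mem_homogeneousC2 (M := M) hV0 hc x.idx hK w
    rw [← totalWt_cons, ← degree_cons, ← totalWt_perm hperm, ← degree_perm hperm, hs, hD] at this
    exact hlower w this
  push Not at hlarge
  by_cases hheavy : ∃ x ∈ L, h < x.wt
  · obtain ⟨x, hxL, hxh⟩ := hheavy
    obtain ⟨L₁, L₂, rfl⟩ := List.append_of_mem hxL
    have hperm : (L₁ ++ x :: L₂).Perm (x :: (L₁ ++ L₂)) := List.perm_middle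
    have hhom := hL.perm hperm
    obtain ⟨hx, hK⟩ := isHomogeneous_cons.1 hhom
    refine wordAction_mem_of_perm hV0 hL hperm (by rw [hs, hD]; exact hlower w) ?_
    have := fieldCoeff_wordAction_mem_of_mem_homogeneousC2 (M := M) hV0 (hh _ hxh hx.2) x.idx hK w
    rw [← totalWt_cons, ← degree_cons, ← totalWt_perm hperm, ← degree_perm hperm, hs, hD] at this
    simpa using hlower w this
  push Not at hheavy
  obtain ⟨p, hp⟩ := exists_lt_countP_of_lt_degree hheavy hlarge (by rw [hD]; exact hdeg)
  -- The letters of index `p` are collected in `L₁`. Their product has weight greater than `h`, and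
  -- therefore lies in `C₂(V)`.
  set L₁ := L.filter (·.idx = p) with hL₁
  set L₂ := L.filter (fun x => !decide (x.idx = p)) with hL₂
  have hperm : L.Perm (L₁ ++ L₂) := (List.filter_append_perm (fun x => decide (x.idx = p)) L).symm
  have hhom := hL.perm hperm
  obtain ⟨hhom₁, hhom₂⟩ := isHomogeneous_append.1 hhom
  have hidx₁ : ∀ x ∈ L₁, x.idx = p := fun x hx => by simpa using (List.mem_filter.1 hx).2
  have hwt₁ : h < totalWt L₁ := by
    have := hhom₁.length_le
    rw [List.countP_eq_length_filter, ← hL₁] at hp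
    omega
  have hwt := totalWt_perm hperm
  have hdg := degree_perm hperm
  have hsq := sqSum_perm hperm
  rw [totalWt_append] at hwt
  rw [degree_append] at hdg
  rw [sqSum_append] at hsq
  refine wordAction_mem_of_perm hV0 hL hperm (by rw [hs, hD]; exact hlower w) ?_
  rw [wordAction_append]
  have hprod : fieldCoeff M.Y (normalProduct A L₁) (L₁.length * p) (M.wordAction L₂ w) ∈
      M.spaceCRel U m := by
    have := fieldCoeff_wordAction_mem_of_mem_homogeneousC2 (M := M) hV0
      (hh _ hwt₁ (normalProduct_mem_weightSpace hhom₁)) (L₁.length * p) hhom₂ w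
    rw [← degree_eq_of_forall_idx_eq hidx₁, ← hwt, ← hdg, hs, hD] at this
    exact hlower w this
  have hspread : M.wordSpan (spreadWords A (totalWt L₁) (degree L₁) (sqSum L₁))
      (M.wordAction L₂ w) ≤ M.spaceCRel U m := by
    refine wordSpan_le ?_
    rintro K ⟨h1, h2, h3⟩
    rw [← wordAction_append]
    have h4 : IsHomogeneous A (K ++ L₂) := isHomogeneous_append.2 ⟨h1, hhom₂⟩
    have h5 : degree (K ++ L₂) = D := by rw [degree_append, h2, ← hdg, hD]
    rcases h3 with h3 | ⟨h3, h3'⟩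
    · exact ihs _ (by rw [totalWt_append]; omega) h4 (by rw [h5]; exact hdeg) w rfl
    · refine ihr _ ?_ h4 w (by rw [totalWt_append, h3, ← hwt, hs]) h5 rfl
      have h6 := hB L hL hs hD hlarge
      rw [← hr, sqSum_append]
      omega
  have := sub_mem hprod (hspread (fieldCoeff_normalProduct_sub_mem (M := M) hV0 hhom₁ hidx₁
    (M.wordAction L₂ w)))
  simpa using this

/-! ### Generation of `W` from a complement of `B₁(W)` -/

/-- The span of all `u(-n)w` with `n ≥ 1` and `u ∈ U` homogeneous of positive weight. -/
def positiveModeSpan (M : WeakVOAModule A W) (U : Submodule ℂ V) : Submodule ℂ W :=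
  Submodule.span ℂ {x | ∃ k : ℕ, 0 < k ∧ ∃ u ∈ U ⊓ A.weightSpace k, ∃ (i : ℕ) (w : W),
    x = fieldCoeff M.Y u i w}

/-- Induction on the weight removes the `C₂(V)`-component of `a`. In weight `0`, where `a` is a
multiple of the vacuum, the index `0`, for which `a_[0]` is a scalar, has to be excluded. -/
theorem fieldCoeff_mem_positiveModeSpan
    (hV0 : A.weightSpace 0 = Submodule.span ℂ {A.vacuum}) {U : Submodule ℂ V}
    (hU : ∀ k, A.weightSpace k ≤ (U ⊓ A.weightSpace k) ⊔ A.homogeneousC2 k) {k : ℕ} {a : V}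
    (ha : a ∈ A.weightSpace k) {n : ℤ} (hn : 0 ≤ n) (hkn : 0 < k ∨ 0 < n) (w : W) :
    fieldCoeff M.Y a n w ∈ M.positiveModeSpan U := by
  induction k using Nat.strong_induction_on generalizing a n w with
  | _ k ih =>
  rcases Nat.eq_zero_or_pos k with rfl | hk
  · rw [hV0] at ha
    obtain ⟨c, rfl⟩ := Submodule.mem_span_singleton.1 ha
    rw [fieldCoeff_smul, fieldCoeff, M.vacuum_mode, if_neg (by omega)]
    simp
  obtain ⟨u, hu, c, hc, rfl⟩ := Submodule.mem_sup.1 (hU _ ha)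
  rw [fieldCoeff_add, LinearMap.add_apply]
  obtain ⟨i, rfl⟩ := Int.eq_ofNat_of_zero_le hn
  refine add_mem (Submodule.subset_span ⟨k, hk, u, hu, i, w, rfl⟩) ?_
  clear ha hu
  induction hc using Submodule.span_induction with
  | zero => simp [fieldCoeff_zero]
  | add x y _ _ hx hy => rw [fieldCoeff_add]; exact add_mem hx hy
  | smul c x _ hx => rw [fieldCoeff_smul]; exact Submodule.smul_mem _ _ hx
  | mem x hx =>
    obtain ⟨k₁, k₂, hk₁₂, a, ha, b, hb, rfl⟩ := hx
    rw [fieldCoeff, M.borcherds.associativity]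
    refine finsum_mem fun t => zsmul_mem (sub_mem ?_ (Submodule.smul_mem _ _ ?_)) _
    · have := ih k₁ (by omega) ha (n := 1 + t) (by omega) (by omega)
        (fieldMode M.Y b (-(i : ℤ) - 1 + t) w)
      rw [fieldCoeff] at this
      convert this using 3
      ring
    · have := ih k₂ (by omega) hb (n := i + 2 + t) (by omega) (by omega) (fieldMode M.Y a t w)
      rw [fieldCoeff] at this
      convert this using 3
      ring

theorem spaceB_le_positiveModeSpan
    (hV0 : A.weightSpace 0 = Submodule.span ℂ {A.vacuum}) {U : Submodule ℂ V}
    (hU : ∀ k, A.weightSpace k ≤ (U ⊓ A.weightSpace k) ⊔ A.homogeneousC2 k) :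
    M.spaceB ≤ M.positiveModeSpan U := by
  refine Submodule.span_le.2 ?_
  rintro _ ⟨k, hk, a, ha, w, rfl⟩
  simpa [fieldCoeff] using fieldCoeff_mem_positiveModeSpan (M := M) hV0 hU ha le_rfl (.inl hk) w

/-- The subspace obtained from `X` by at most `r` applications of operators `u_[i]` with `u ∈ U` and
`0 ≤ i ≤ d`. -/
def iteratedModeSpan (M : WeakVOAModule A W) (U : Submodule ℂ V) (X : Submodule ℂ W) (d : ℕ) :
    ℕ → Submodule ℂ W
  | 0 => X
  | r + 1 => iteratedModeSpan M U X d r ⊔ (Finset.range (d + 1)).sup fun i =>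
      Submodule.map₂ (fieldModeLinear M.Y (-(i : ℤ) - 1)) U (iteratedModeSpan M U X d r)

theorem iteratedModeSpan_fg {U : Submodule ℂ V} (hU : U.FG) {X : Submodule ℂ W} (hX : X.FG)
    (d r : ℕ) : (M.iteratedModeSpan U X d r).FG := by
  induction r with
  | zero => exact hX
  | succ r ih => exact ih.sup (Submodule.fg_finset_sup _ _ fun i _ => hU.map₂ _ ih)

theorem iteratedModeSpan_mono (U : Submodule ℂ V) (X : Submodule ℂ W) (d : ℕ) :
    Monotone (M.iteratedModeSpan U X d) :=
  monotone_nat_of_le_succ fun _ => le_sup_left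

theorem wordAction_mem_iteratedModeSpan {U : Submodule ℂ V} {X : Submodule ℂ W} {d : ℕ}
    {L : List (ModeLetter V)} (hL : ∀ x ∈ L, x.vec ∈ U ∧ 0 ≤ x.idx ∧ x.idx ≤ d) {w : W}
    (hw : w ∈ X) : M.wordAction L w ∈ M.iteratedModeSpan U X d L.length := by
  induction L with
  | nil => simpa [iteratedModeSpan] using hw
  | cons x L ih =>
    obtain ⟨h1, h2, h3⟩ := hL x List.mem_cons_self
    obtain ⟨i, hi⟩ := Int.eq_ofNat_of_zero_le h2
    have hle : Submodule.map₂ (fieldModeLinear M.Y (-(i : ℤ) - 1)) U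
        (M.iteratedModeSpan U X d L.length) ≤ M.iteratedModeSpan U X d (L.length + 1) :=
      le_sup_of_le_right (Finset.le_sup (f := fun i : ℕ => Submodule.map₂
        (fieldModeLinear M.Y (-(i : ℤ) - 1)) U (M.iteratedModeSpan U X d L.length))
        (Finset.mem_range.2 (by omega)))
    rw [wordAction_cons, hi]
    exact hle (Submodule.apply_mem_map₂ _ h1 (ih fun y hy => hL y (List.mem_cons_of_mem _ hy)))

/-- Suppose that `X` and the modes `u_[i]` with `u ∈ U` homogeneous of positive weight and `i ≥ 0`
generate `W` in one step, and that words of degree greater than `d` map `W` into `C`. Then iterating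
the one-step generation, each step of which raises the degree, exhausts `W` modulo `C`. -/
theorem wordAction_mem_sup_iteratedModeSpan {U : Submodule ℂ V} {X C : Submodule ℂ W} {d : ℕ}
    (hX : X ⊔ M.positiveModeSpan U = ⊤)
    (hC : ∀ L, IsHomogeneous A L → (d : ℤ) < degree L → ∀ w, M.wordAction L w ∈ C)
    {L : List (ModeLetter V)} (hL : IsHomogeneous A L) (hLU : ∀ x ∈ L, x.vec ∈ U ∧ 0 ≤ x.idx)
    (w : W) : M.wordAction L w ∈ C ⊔ M.iteratedModeSpan U X d d := by
  obtain ⟨r, hr⟩ : ∃ r, ((d : ℤ) + 1 - degree L).toNat = r := ⟨_, rfl⟩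
  induction r using Nat.strong_induction_on generalizing L w with
  | _ r ih =>
  rcases lt_or_ge (d : ℤ) (degree L) with hlt | hge
  · exact Submodule.mem_sup_left (hC L hL hlt w)
  have hw : w ∈ X ⊔ M.positiveModeSpan U := by rw [hX]; trivial
  obtain ⟨x, hx, y, hy, rfl⟩ := Submodule.mem_sup.1 hw
  clear hw
  rw [map_add]
  refine add_mem (Submodule.mem_sup_right ?_) ?_
  · have h1 := idx_le_degree fun x hx => (hLU x hx).2
    have h2 := totalWt_le_degree fun x hx => (hLU x hx).2
    have h3 := hL.length_le
    refine iteratedModeSpan_mono U X d (show L.length ≤ d by omega)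
      (wordAction_mem_iteratedModeSpan (fun x hx => ⟨(hLU x hx).1, (hLU x hx).2, ?_⟩) hx)
    have := h1.2 x hx
    omega
  · induction hy using Submodule.span_induction with
    | zero => simp
    | add x y _ _ hx hy => rw [map_add]; exact add_mem hx hy
    | smul c x _ hx => rw [map_smul]; exact Submodule.smul_mem _ _ hx
    | mem y hy =>
      obtain ⟨k, hk, u, hu, i, v, rfl⟩ := hy
      have hhom : IsHomogeneous A (L ++ [⟨u, k, i⟩]) :=
        isHomogeneous_append.2 ⟨hL, isHomogeneous_cons.2 ⟨⟨hk, hu.2⟩, IsHomogeneous.nil A⟩⟩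
      have hLU' : ∀ x ∈ L ++ [(⟨u, k, i⟩ : ModeLetter V)], x.vec ∈ U ∧ 0 ≤ x.idx := by
        intro x hx
        rcases List.mem_append.1 hx with hx | hx
        · exact hLU x hx
        · obtain rfl := List.mem_singleton.1 hx
          exact ⟨hu.1, by simp⟩
      have hdeg : degree (L ++ [(⟨u, k, i⟩ : ModeLetter V)]) = degree L + (k + i) := by simp
      have := ih _ (by rw [← hr]; omega) hhom hLU' v rfl
      simpa using this

end WeakVOAModule

theorem mainTheorem2 {V : Type u} [AddCommGroup V] [Module ℂ V] (A : VertexOperatorAlgebra V)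
    (hV0 : A.weightSpace 0 = Submodule.span ℂ {A.vacuum})
    (hC2 : A.adjointModule.IsCFinite 2)
    (U : Submodule ℂ V) (hUgraded : A.IsGradedSubspace U)
    (hU : IsCompl U (A.adjointModule.spaceC 2))
    {W : Type v} [AddCommGroup W] [Module ℂ W] (M : WeakVOAModule A W) (hB1 : M.IsBFinite)
    (m : ℕ) (hm : 0 < m) :
    FiniteDimensional ℂ (W ⧸ M.spaceCRel U m) := by
  have hsup := A.weightSpace_le_sup hUgraded hU
  obtain ⟨h, hh⟩ := A.exists_weightSpace_le_homogeneousC2 hC2 hUgraded hU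
  have hUfg : U.FG := (Submodule.fg_top U).1 (A.finiteDimensional_of_isCompl hC2 hU).fg_top
  obtain ⟨X, hX⟩ := Submodule.exists_isCompl M.spaceB
  have hXfg : X.FG := by
    have : FiniteDimensional ℂ (W ⧸ M.spaceB) := hB1
    have : Module.Finite ℂ X := Module.Finite.equiv (Submodule.quotientEquivOfIsCompl _ _ hX)
    exact (Submodule.fg_top X).1 this.fg_top
  have hXtop : X ⊔ M.positiveModeSpan U = ⊤ := top_le_iff.1 <| hX.symm.sup_eq_top.ge.trans
    (sup_le_sup_left (WeakVOAModule.spaceB_le_positiveModeSpan hV0 hsup) X)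
  -- A bound for the degree of words that do not map `W` into `C_m(U, W)`.
  obtain ⟨d, hd⟩ : ∃ d : ℕ, d = h * (h + m) ^ 2 := ⟨_, rfl⟩
  have htop : M.spaceCRel U m ⊔ M.iteratedModeSpan U X d d = ⊤ := by
    refine top_le_iff.1 fun w _ => ?_
    simpa using WeakVOAModule.wordAction_mem_sup_iteratedModeSpan (M := M) (L := []) (d := d) hXtop
      (fun L hL hdeg w => WeakVOAModule.wordAction_mem_spaceCRel hV0 hsup hh m hL
        (by rw [hd] at hdeg; exact_mod_cast hdeg) w) (ModeLetter.IsHomogeneous.nil A) (by simp) w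
  have hfg := WeakVOAModule.iteratedModeSpan_fg (M := M) hUfg hXfg d d
  refine Module.finite_def.2 ?_
  have : Submodule.map (M.spaceCRel U m).mkQ (M.iteratedModeSpan U X d d) = ⊤ := by
    rw [← Submodule.range_mkQ (M.spaceCRel U m), ← Submodule.map_top, ← htop, Submodule.map_sup,
      Submodule.mkQ_map_self, bot_sup_eq]
  exact this ▸ hfg.map _
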